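/- Let $V$ be a finite-dimensional real Euclidean space, and let $W \subset O(V)$ be a finite reflection group, i.e. a finite subgroup generated by orthogonal reflections. For $0\neq\alpha\in V$ let $s_\alpha$ be the orthogonal reflection fixing $\alpha^\perp$ pointwise. Let $\Phi$ be a root system for $W$: a finite set of nonzero vectors, stable under $W$, with $\mathbb R\alpha\cap\Phi=\{\alpha,-\alpha\}$ for all $\alpha\in\Phi$ and $W=\langle s_\alpha \mid \alpha\in\Phi\rangle$. A simple system of $\Phi$ is a minimal set of generators, taken from $\Phi^+$, of the convex cone spanned by $\Phi^+$, where $\Phi^+$ is the set of roots on one side of some hyperplane through $0$ containing no root. For a finite reflection group $G\subset O(V)$, a point $b\in V$ is called generic for $G$ if it is fixed by no reflection in $G$, and then $\mathrm{Perm}^{b}(G)=\mathrm{conv}\{g(b) \mid g\in G\}$. Let $a\in V$ be generic for $W$, let $\Delta$ be the simple system of $\Phi$ with $\langle a,\alpha\rangle>0$ for all $\alpha\in\Delta$, and let $S=\{s_\alpha\mid\alpha\in\Delta\}$. For $I\subseteq S$ let $W_I=\langle I\rangle$ (a standard parabolic subgroup) and $F_I=\mathrm{Perm}^{a}(W_I)$.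 1. Every face of dimension $k$ of $\mathrm{Perm}^a(W)$ is of the form $w(F_I)$ with $w\in W$, $I\subseteq S$ and $|I|=k$. Conversely, for all $w\in W$ and $I\subseteq S$, the set $w(F_I)$ is a face of dimension $|I|$. Moreover it is a permutahedron: $wW_Iw^{-1}$ is a finite reflection group, $w(a)$ is generic for it, and $w(F_I)=\mathrm{Perm}^{w(a)}(wW_Iw^{-1})$. 2. For $w,g\in W$ and $I\subseteq S$: $w(F_I)=g(F_I)$ if and only if $wW_I=gW_I$. 3. For $w,g\in W$ and $I,J\subseteq S$: $w(F_I)\subseteq g(F_J)$ if and only if $wW_I\subseteq gW_J$. The map $w(F_I)\mapsto wW_I$ extends to an isomorphism from the face lattice of $\mathrm{Perm}^a(W)$ (all faces, including the empty one, ordered by inclusion) onto the poset $\{wW_I\mid w\in W,\ I\subseteq S\}$, ordered by inclusion, with an additional least element adjoined (the image of the empty face). -/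

import Mathlib

open scoped Pointwise

noncomputable section

namespace PermFaces

variable {V : Type*} [NormedAddCommGroup V] [InnerProductSpace ℝ V]

/-- The orthogonal reflection `s_α` fixing the hyperplane `α^⊥` pointwise and sending `α` to `-α`
(for `α ≠ 0`), as an element of the orthogonal group `O(V) = (V ≃ₗᵢ[ℝ] V)`. -/
def rootRefl (α : V) : V ≃ₗᵢ[ℝ] V := (ℝ ∙ α)ᗮ.reflection

/-- `s` is an orthogonal reflection. -/
def IsRefl (s : V ≃ₗᵢ[ℝ] V) : Prop := ∃ α : V, α ≠ 0 ∧ s = rootRefl α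

/-- A finite reflection group: a finite subgroup of `O(V)` generated by reflections. -/
def IsFiniteReflectionGroup (W : Subgroup (V ≃ₗᵢ[ℝ] V)) : Prop :=
  Finite W ∧ ∃ R : Set (V ≃ₗᵢ[ℝ] V), (∀ s ∈ R, IsRefl s) ∧ W = Subgroup.closure R

/-- `a` is generic for `W`: it is not fixed by any reflection in `W`. -/
def IsGeneric (W : Subgroup (V ≃ₗᵢ[ℝ] V)) (a : V) : Prop :=
  ∀ s ∈ W, IsRefl s → s a ≠ a

/-- The permutahedron `Perm^a(W)`: the convex hull of the `W`-orbit of `a`. -/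
def Perm (a : V) (W : Subgroup (V ≃ₗᵢ[ℝ] V)) : Set V :=
  convexHull ℝ {x | ∃ w ∈ W, x = w a}

/-- `Φ` is a root system for `W`. (The empty set is allowed, for the trivial group.) -/
structure IsRootSystemFor (W : Subgroup (V ≃ₗᵢ[ℝ] V)) (Φ : Set V) : Prop where
  finite : Φ.Finite
  zero_notMem : (0 : V) ∉ Φ
  generates : W = Subgroup.closure (rootRefl '' Φ)
  line_inter : ∀ α ∈ Φ, ((ℝ ∙ α : Submodule ℝ V) : Set V) ∩ Φ = {α, -α}
  stable : ∀ w ∈ W, ∀ α ∈ Φ, w α ∈ Φ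

/-- `Φp` is a set of positive roots of `Φ`: the roots on one side of a linear hyperplane `ker f`
that contains no root. -/
def IsPositiveSystem (Φ Φp : Set V) : Prop :=
  ∃ f : V →ₗ[ℝ] ℝ, (∀ α ∈ Φ, f α ≠ 0) ∧ Φp = {α ∈ Φ | 0 < f α}

/-- `Δ` is a simple system of `Φ`: for some set of positive roots `Φp`, it is a basis of the
polyhedral cone generated by `Φp`, i.e. a minimal subset of `Φp` generating the same cone. -/
def IsSimpleSystem (Φ Δ : Set V) : Prop :=
  ∃ Φp : Set V, IsPositiveSystem Φ Φp ∧
    Minimal (fun D : Set V => D ⊆ Φp ∧ PointedCone.hull ℝ D = PointedCone.hull ℝ Φp) Δ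

/-- The simple reflections `S = {s_α | α ∈ Δ}`. -/
def simpleReflections (Δ : Set V) : Set (V ≃ₗᵢ[ℝ] V) := rootRefl '' Δ

/-- `F` is a nonempty set whose affine span has dimension `k`. -/
def HasDim (F : Set V) (k : ℕ) : Prop :=
  F.Nonempty ∧ Module.finrank ℝ (affineSpan ℝ F).direction = k

/-- The face lattice of the polytope `P`: all its faces, including `∅` and `P` itself, ordered by
inclusion. A nonempty face is the set of maximizers over `P` of a linear functional. -/
abbrev FaceLattice (P : Set V) : Type _ := {F : Set V // IsExposed ℝ P F}

/-- The poset, under inclusion, of the cosets `w W_I` (`w ∈ W`, `I ⊆ S`) of the standard parabolic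
subgroups `W_I = ⟨I⟩`. -/
abbrev ParabolicCosets (W : Subgroup (V ≃ₗᵢ[ℝ] V)) (S : Set (V ≃ₗᵢ[ℝ] V)) : Type _ :=
  {C : Set (V ≃ₗᵢ[ℝ] V) //
    ∃ w ∈ W, ∃ I ⊆ S, C = w • (Subgroup.closure I : Set (V ≃ₗᵢ[ℝ] V))}

end PermFaces

end

/-!
A linear functional `f` can be moved by `W` to a dominant one, nonnegative on `Δ`, so only the
maximizers of a dominant `f` on the orbit `W a` matter. Let `D` be the set of simple roots on which
`f` vanishes. In the coset `W_D w`, on whose points `g a` the value of `f` is constant, take the `g`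
for which `g a` is highest in the direction `a`. If `w a` maximizes `f`, then `g a` pairs
nonnegatively with every simple root, since otherwise a simple reflection would raise `f` or the
height, and the exchange condition leaves only `g = 1`. Hence the maximizers are exactly the points
of `W_D a`. Conversely, simple roots are linearly independent, so every `D ⊆ Δ` is the set of
simple roots annihilated by some dominant `f`.

The stabilizer of `a` is trivial, so a face `w(F_I)` determines the coset `w W_I` as the set of
`g ∈ W` with `g a` in the face. The differences `a - s_α a`, `α ∈ D`, span the direction of the face
with vertices `W_D a`, which gives its dimension.
-/

noncomputable section

namespace PermFaces

open scoped InnerProductSpace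

section ExposedFaces

lemma image_toExposed_comp {R E F : Type*} [TopologicalSpace R] [Ring R] [PartialOrder R]
    [AddCommMonoid E] [TopologicalSpace E] [Module R E]
    [AddCommMonoid F] [TopologicalSpace F] [Module R F]
    (f : StrongDual R F) (g : E →L[R] F) (A : Set E) :
    g '' (f.comp g).toExposed A = f.toExposed (g '' A) := by
  ext y
  constructor
  · rintro ⟨x, ⟨hx, hmax⟩, rfl⟩
    exact ⟨⟨x, hx, rfl⟩, Set.forall_mem_image.2 hmax⟩
  · rintro ⟨⟨x, hx, rfl⟩, hmax⟩
    exact ⟨x, ⟨hx, Set.forall_mem_image.1 hmax⟩, rfl⟩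

lemma isExposed_image {R E F : Type*} [TopologicalSpace R] [Ring R] [PartialOrder R]
    [AddCommMonoid E] [TopologicalSpace E] [Module R E]
    [AddCommMonoid F] [TopologicalSpace F] [Module R F] {A B : Set E} (h : IsExposed R A B)
    (g : E ≃L[R] F) : IsExposed R (g '' A) (g '' B) := by
  intro hne
  obtain ⟨f, rfl⟩ := h hne.of_image
  refine ⟨f.comp (g.symm : F →L[R] E), ?_⟩
  have himage := image_toExposed_comp (f.comp (g.symm : F →L[R] E)) (g : E →L[R] F) A
  rwa [ContinuousLinearMap.comp_assoc, ContinuousLinearEquiv.coe_symm_comp_coe,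
    ContinuousLinearMap.comp_id] at himage

variable {𝕜 E : Type*} [TopologicalSpace 𝕜] [Field 𝕜] [LinearOrder 𝕜] [IsStrictOrderedRing 𝕜]
  [AddCommGroup E] [TopologicalSpace E] [Module 𝕜 E]

lemma forall_mem_convexHull_le {f : StrongDual 𝕜 E} {s : Set E} {c : 𝕜} (h : ∀ y ∈ s, f y ≤ c) :
    ∀ y ∈ convexHull 𝕜 s, f y ≤ c :=
  convexHull_min h (convex_halfSpace_le f.isLinear c)

lemma toExposed_convexHull (f : StrongDual 𝕜 E) (s : Set E) :
    f.toExposed (convexHull 𝕜 s) = convexHull 𝕜 (f.toExposed s) := by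
  classical
  refine Set.Subset.antisymm ?_ (convexHull_min ?_ ?_)
  · rintro x ⟨hx, hmax⟩
    obtain ⟨ι, t, w, z, hw, hw1, hz, rfl⟩ := (convexHull_eq s).subset hx
    have hle : ∀ i ∈ t, f (z i) ≤ f (t.centerMass w z) := fun i hi =>
      hmax _ (subset_convexHull 𝕜 s (hz i hi))
    have hsum : ∑ i ∈ t, w i * (f (t.centerMass w z) - f (z i)) = 0 := by
      simp only [mul_sub, Finset.sum_sub_distrib, ← Finset.sum_mul, hw1, one_mul]
      simp [Finset.centerMass_eq_of_sum_1 t z hw1]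
    have hslack := (Finset.sum_eq_zero_iff_of_nonneg fun i hi =>
      mul_nonneg (hw i hi) (sub_nonneg.2 (hle i hi))).1 hsum
    rw [← Finset.centerMass_filter_ne_zero]
    refine Finset.centerMass_mem_convexHull _ (fun i hi => hw i (Finset.mem_filter.1 hi).1) ?_ ?_
    · rw [Finset.sum_filter_ne_zero, hw1]
      exact one_pos
    · intro i hi
      obtain ⟨hit, hwi⟩ := Finset.mem_filter.1 hi
      have hfi := sub_eq_zero.1 ((mul_eq_zero.1 (hslack i hit)).resolve_left hwi)
      exact ⟨hz i hit, fun y hy => hfi ▸ hmax y (subset_convexHull 𝕜 s hy)⟩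
  · exact fun x hx => ⟨subset_convexHull 𝕜 s hx.1, forall_mem_convexHull_le hx.2⟩
  · exact ContinuousLinearMap.toExposed.isExposed.convex (convex_convexHull 𝕜 s)

end ExposedFaces

section Cones

variable {𝕜 E : Type*} [Field 𝕜] [LinearOrder 𝕜] [IsStrictOrderedRing 𝕜] [AddCommGroup E]
  [Module 𝕜 E] {s : Set E} {x y z : E} {f : E →ₗ[𝕜] 𝕜}

lemma map_nonneg_of_mem_hull (hf : ∀ y ∈ s, 0 ≤ f y) (hz : z ∈ PointedCone.hull 𝕜 s) :
    0 ≤ f z := by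
  have hle : PointedCone.hull 𝕜 s ≤ (PointedCone.positive 𝕜 𝕜).comap f := Submodule.span_le.2 hf
  exact hle hz

lemma eq_zero_or_map_pos_of_mem_hull (hf : ∀ y ∈ s, 0 < f y) (hz : z ∈ PointedCone.hull 𝕜 s) :
    z = 0 ∨ 0 < f z := by
  induction hz using Submodule.span_induction with
  | mem y hy => exact .inr (hf y hy)
  | zero => exact .inl rfl
  | add u v _ _ hu hv =>
    rcases hu with rfl | hu
    · simpa using hv
    rcases hv with rfl | hv
    · simpa using Or.inr hu
    exact .inr (by simpa using add_pos hu hv)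
  | smul t v _ hv =>
    rcases hv with rfl | hv
    · simp
    obtain ⟨t, ht⟩ := t
    rw [Nonneg.mk_smul, map_smul]
    exact ht.eq_or_lt.imp (fun h0 => by rw [← h0, zero_smul]) fun hpos => mul_pos hpos hv

lemma eq_zero_of_add_eq_zero_of_mem_hull (hf : ∀ y ∈ s, 0 < f y) (hx : x ∈ PointedCone.hull 𝕜 s)
    (hz : z ∈ PointedCone.hull 𝕜 s) (hsum : x + z = 0) : x = 0 := by
  refine (eq_zero_or_map_pos_of_mem_hull hf hx).resolve_right fun hxpos => ?_
  have hznonneg := map_nonneg_of_mem_hull (fun y hy => (hf y hy).le) hz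
  have hadd := congrArg f hsum
  rw [map_add, map_zero] at hadd
  linarith

lemma mem_hull_iff_exists_smul_add (hy : y ∈ s) :
    x ∈ PointedCone.hull 𝕜 s ↔
      ∃ t : 𝕜, 0 ≤ t ∧ ∃ z ∈ PointedCone.hull 𝕜 (s \ {y}), x = t • y + z := by
  conv_lhs => rw [← Set.insert_sdiff_self_of_mem hy]
  simp only [PointedCone.hull, Submodule.mem_span_insert, Subtype.exists, Nonneg.mk_smul,
    exists_prop]

end Cones

section LinearFunctionals

lemma exists_strongDual_apply_eq {𝕜 E ι : Type*} [Field 𝕜] [TopologicalSpace 𝕜]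
    [IsTopologicalRing 𝕜] [AddCommGroup E] [TopologicalSpace E] [Module 𝕜 E] [SeparatingDual 𝕜 E]
    [Finite ι] {v : ι → E} (hv : LinearIndependent 𝕜 v) (c : ι → 𝕜) :
    ∃ f : StrongDual 𝕜 E, ∀ i, f (v i) = c i := by
  classical
  have := Fintype.ofFinite ι
  have hinj : Function.Injective (Fintype.linearCombination 𝕜 v) :=
    linearIndependent_iff_injective_fintypeLinearCombination.1 hv
  obtain ⟨f, hf⟩ := SeparatingDual.dualMap_surjective_iff.2 hinj (Fintype.linearCombination 𝕜 c)
  refine ⟨f, fun i => ?_⟩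
  simpa using LinearMap.congr_fun hf (Pi.single i 1)

end LinearFunctionals

variable {V : Type*} [NormedAddCommGroup V] [InnerProductSpace ℝ V]

section Reflections

lemma rootRefl_apply (α v : V) : rootRefl α v = v - (2 * (⟪α, v⟫_ℝ / ‖α‖ ^ 2)) • α := by
  rw [rootRefl, Submodule.reflection_orthogonal_apply, Submodule.reflection_singleton_apply,
    neg_sub, mul_smul, ofNat_smul_eq_nsmul ℝ]
  rfl

lemma rootRefl_self (α : V) : rootRefl α α = -α :=
  Submodule.reflection_orthogonalComplement_singleton_eq_neg α

lemma rootRefl_neg (α : V) : rootRefl (-α) = rootRefl α := by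
  ext v
  simp [rootRefl_apply, neg_div]

lemma rootRefl_mul_self (α : V) : rootRefl α * rootRefl α = 1 :=
  Submodule.reflection_mul_reflection _

lemma rootRefl_inv (α : V) : (rootRefl α)⁻¹ = rootRefl α :=
  Submodule.reflection_inv

lemma rootRefl_rootRefl (α v : V) : rootRefl α (rootRefl α v) = v :=
  Submodule.reflection_reflection _ v

lemma rootRefl_ne_one {α : V} (hα : α ≠ 0) : rootRefl α ≠ 1 := by
  intro h
  have : IsAddTorsionFree V := .of_isTorsionFree ℝ V
  exact hα (self_eq_neg.1 ((DFunLike.congr_fun h α).symm.trans (rootRefl_self α)))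

lemma conj_rootRefl (w : V ≃ₗᵢ[ℝ] V) (α : V) : w * rootRefl α * w⁻¹ = rootRefl (w α) := by
  rw [mul_inv_eq_iff_eq_mul]
  ext v
  simp [rootRefl_apply]

lemma inner_rootRefl_left (α x y : V) : ⟪rootRefl α x, y⟫_ℝ = ⟪x, rootRefl α y⟫_ℝ := by
  rw [← (rootRefl α).inner_map_map, rootRefl_rootRefl]

lemma map_rootRefl_le_iff {f : StrongDual ℝ V} {α v : V} (h : 0 < ⟪α, v⟫_ℝ) :
    f (rootRefl α v) ≤ f v ↔ 0 ≤ f α := by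
  have hα : α ≠ 0 := by
    rintro rfl
    simp at h
  have hc : 0 < 2 * (⟪α, v⟫_ℝ / ‖α‖ ^ 2) := by positivity
  rw [rootRefl_apply, map_sub, map_smul, smul_eq_mul, sub_le_self_iff,
    mul_nonneg_iff_of_pos_left hc]

lemma map_rootRefl_lt_iff {f : StrongDual ℝ V} {α v : V} (h : 0 < ⟪α, v⟫_ℝ) :
    f (rootRefl α v) < f v ↔ 0 < f α := by
  simpa using not_congr (map_rootRefl_le_iff (f := -f) h)

lemma lt_map_rootRefl_iff {f : StrongDual ℝ V} {α v : V} (h : ⟪α, v⟫_ℝ < 0) :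
    f v < f (rootRefl α v) ↔ 0 < f α := by
  simpa using map_rootRefl_lt_iff (f := f) (v := -v) (by simpa using h)

lemma map_rootRefl_of_map_eq_zero {f : StrongDual ℝ V} {α : V} (h : f α = 0) (v : V) :
    f (rootRefl α v) = f v := by
  simp [rootRefl_apply, h]

end Reflections

section ReflectionGroups

/-- The group generated by the reflections `s_α`, `α ∈ D`. For a set `D` of simple roots this is the
standard parabolic subgroup `W_I` with `I = {s_α | α ∈ D}`. -/
abbrev reflGroup (D : Set V) : Subgroup (V ≃ₗᵢ[ℝ] V) := Subgroup.closure (rootRefl '' D)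

variable {D E : Set V} {α a : V} {w : V ≃ₗᵢ[ℝ] V} {f : StrongDual ℝ V}

lemma rootRefl_mem_reflGroup (hα : α ∈ D) : rootRefl α ∈ reflGroup D :=
  Subgroup.subset_closure ⟨α, hα, rfl⟩

lemma reflGroup_mono (h : D ⊆ E) : reflGroup D ≤ reflGroup E :=
  Subgroup.closure_mono (Set.image_mono h)

@[elab_as_elim]
lemma reflGroup_induction {p : ∀ w, w ∈ reflGroup D → Prop} (one : p 1 (one_mem _))
    (rootRefl_mul : ∀ α (hα : α ∈ D) w (hw : w ∈ reflGroup D), p w hw →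
      p (rootRefl α * w) (mul_mem (rootRefl_mem_reflGroup hα) hw))
    (hw : w ∈ reflGroup D) : p w hw := by
  induction hw using Subgroup.closure_induction_left with
  | one => exact one
  | mul_left s hs w hw ih =>
    obtain ⟨α, hα, rfl⟩ := hs
    exact rootRefl_mul α hα w hw ih
  | inv_mul_cancel s hs w hw ih =>
    obtain ⟨α, hα, rfl⟩ := hs
    simpa only [rootRefl_inv] using rootRefl_mul α hα w hw ih

lemma map_apply_of_mem_reflGroup (hf : ∀ α ∈ D, f α = 0) (hw : w ∈ reflGroup D) (v : V) :
    f (w v) = f v := by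
  induction hw using reflGroup_induction with
  | one => rfl
  | rootRefl_mul α hα w _ ih => exact (map_rootRefl_of_map_eq_zero (hf α hα) _).trans ih

lemma apply_sub_mem_span (hw : w ∈ reflGroup D) (v : V) : w v - v ∈ Submodule.span ℝ D := by
  induction hw using reflGroup_induction with
  | one => simp
  | rootRefl_mul α hα w _ ih =>
    rw [LinearIsometryEquiv.coe_mul, Function.comp_apply, rootRefl_apply, sub_right_comm]
    exact sub_mem ih (Submodule.smul_mem _ _ (Submodule.subset_span hα))

lemma eq_one_of_forall_mem_apply_eq (hw : w ∈ reflGroup D) (hfix : ∀ α ∈ D, w α = α) : w = 1 := by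
  ext v
  have hspan : ∀ u ∈ Submodule.span ℝ D, w u = u := fun u hu =>
    LinearMap.eqOn_span (f := w.toLinearEquiv.toLinearMap) (g := .id) hfix hu
  have horth : ⟪w v - v, w v - v⟫_ℝ = 0 := by
    rw [inner_sub_right, sub_eq_zero]
    nth_rw 1 [← hspan _ (apply_sub_mem_span hw v)]
    exact w.inner_map_map _ _
  exact sub_eq_zero.1 (inner_self_eq_zero.1 horth)

lemma exists_forall_map_apply_nonneg (G : Subgroup (V ≃ₗᵢ[ℝ] V)) [Finite G]
    (hG : ∀ α ∈ D, rootRefl α ∈ G) (ha : ∀ α ∈ D, 0 < ⟪a, α⟫_ℝ) (f : StrongDual ℝ V) :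
    ∃ u ∈ G, ∀ α ∈ D, 0 ≤ f (u α) := by
  obtain ⟨⟨u, hu⟩, hmax⟩ := Finite.exists_max fun u : G => f ((u : V ≃ₗᵢ[ℝ] V) a)
  refine ⟨u, hu, fun α hα => ?_⟩
  have hle := hmax ⟨u * rootRefl α, mul_mem hu (hG α hα)⟩
  exact (map_rootRefl_le_iff (f := f.comp (u : V →L[ℝ] V)) (real_inner_comm α a ▸ ha α hα)).1 hle

/-- The product `s_{α₁} ⋯ s_{αₙ}` of the word `α₁ ⋯ αₙ`. -/
def wordProd (l : List D) : V ≃ₗᵢ[ℝ] V := (l.map fun α : D => rootRefl (α : V)).prod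

lemma wordProd_cons (γ : D) (l : List D) :
    wordProd (γ :: l) = rootRefl (γ : V) * wordProd l := by
  simp [wordProd]

lemma wordProd_mem_reflGroup (l : List D) : wordProd l ∈ reflGroup D :=
  list_prod_mem fun _ hs => by
    obtain ⟨α, -, rfl⟩ := List.mem_map.1 hs
    exact rootRefl_mem_reflGroup α.2

lemma exists_wordProd_eq (hw : w ∈ reflGroup D) : ∃ l : List D, wordProd l = w := by
  induction hw using reflGroup_induction with
  | one => exact ⟨[], rfl⟩
  | rootRefl_mul α hα w _ ih =>
    obtain ⟨l, rfl⟩ := ih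
    exact ⟨⟨α, hα⟩ :: l, wordProd_cons _ l⟩

end ReflectionGroups

/-- A root system `Φ` for `W` with a simple system `Δ` and a point `a` of the open chamber of `Δ`.
This is the situation in which the faces of the permutahedron `Perm a W` are determined. -/
structure IsBasedRootSystem (W : Subgroup (V ≃ₗᵢ[ℝ] V)) (Φ Δ : Set V) (a : V) : Prop
    extends IsRootSystemFor W Φ where
  isSimpleSystem : IsSimpleSystem Φ Δ
  inner_pos : ∀ α ∈ Δ, 0 < ⟪a, α⟫_ℝ

section RootSystems

variable {W : Subgroup (V ≃ₗᵢ[ℝ] V)} {Φ Δ : Set V}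

namespace IsRootSystemFor

variable (h : IsRootSystemFor W Φ)
include h

lemma ne_zero {β : V} (hβ : β ∈ Φ) : β ≠ 0 := ne_of_mem_of_not_mem hβ h.zero_notMem

lemma rootRefl_mem {α : V} (hα : α ∈ Φ) : rootRefl α ∈ W :=
  h.generates ▸ rootRefl_mem_reflGroup hα

lemma neg_mem {β : V} (hβ : β ∈ Φ) : -β ∈ Φ :=
  rootRefl_self β ▸ h.stable _ (h.rootRefl_mem hβ) β hβ

lemma eq_or_eq_neg {α : V} (hα : α ∈ Φ) {t : ℝ} (ht : t • α ∈ Φ) : t • α = α ∨ t • α = -α :=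
  (h.line_inter α hα).subset ⟨Submodule.mem_span_singleton.2 ⟨t, rfl⟩, ht⟩

lemma finite_group : Finite W := by
  have : Finite Φ := h.finite
  let act : W → Φ → Φ := fun w β => ⟨(w : V ≃ₗᵢ[ℝ] V) β, h.stable w w.2 β β.2⟩
  refine Finite.of_injective act fun w g hwg => ?_
  have hone : (g : V ≃ₗᵢ[ℝ] V)⁻¹ * w = 1 := by
    refine eq_one_of_forall_mem_apply_eq (D := Φ) ?_ fun β hβ => ?_
    · rw [reflGroup, ← h.generates]
      exact mul_mem (inv_mem g.2) w.2
    · have hβ : (w : V ≃ₗᵢ[ℝ] V) β = (g : V ≃ₗᵢ[ℝ] V) β :=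
        congrArg Subtype.val (congrFun hwg ⟨β, hβ⟩)
      exact (g : V ≃ₗᵢ[ℝ] V).symm_apply_eq.2 hβ
  exact Subtype.ext (inv_mul_eq_one.1 hone).symm

end IsRootSystemFor

namespace IsSimpleSystem

variable (h : IsSimpleSystem Φ Δ)
include h

lemma subset : Δ ⊆ Φ := by
  obtain ⟨_, ⟨_, _, rfl⟩, hΔ⟩ := h
  exact hΔ.prop.1.trans (Set.sep_subset _ _)

lemma notMem_hull_sdiff {α : V} (hα : α ∈ Δ) : α ∉ PointedCone.hull ℝ (Δ \ {α}) := by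
  obtain ⟨Φp, -, hΔ⟩ := h
  intro hmem
  have hhull : PointedCone.hull ℝ (Δ \ {α}) = PointedCone.hull ℝ Δ := by
    conv_rhs => rw [← Set.insert_sdiff_self_of_mem hα]
    exact (Submodule.span_insert_eq_span hmem).symm
  exact (hΔ.le_of_le ⟨Set.sdiff_subset.trans hΔ.prop.1, hhull.trans hΔ.prop.2⟩
    Set.sdiff_subset hα).2 rfl

lemma mem_hull_or_neg_mem_hull (hneg : ∀ β ∈ Φ, -β ∈ Φ) {β : V} (hβ : β ∈ Φ) :
    β ∈ PointedCone.hull ℝ Δ ∨ -β ∈ PointedCone.hull ℝ Δ := by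
  obtain ⟨_, ⟨f, hf, rfl⟩, hΔ⟩ := h
  rw [hΔ.prop.2]
  rcases (hf β hβ).lt_or_gt with hlt | hgt
  · exact .inr (PointedCone.subset_hull ⟨hneg β hβ, by simpa using hlt⟩)
  · exact .inl (PointedCone.subset_hull ⟨hβ, hgt⟩)

end IsSimpleSystem

namespace IsBasedRootSystem

variable {a : V} (h : IsBasedRootSystem W Φ Δ a)
include h

lemma subset : Δ ⊆ Φ := h.isSimpleSystem.subset

lemma inner_ne_zero {β : V} (hβ : β ∈ Φ) : ⟪a, β⟫_ℝ ≠ 0 := by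
  have hpos : ∀ α ∈ Δ, 0 < innerₗ V a α := h.inner_pos
  rcases h.isSimpleSystem.mem_hull_or_neg_mem_hull (fun _ => h.neg_mem) hβ with hmem | hmem
  · exact ((eq_zero_or_map_pos_of_mem_hull hpos hmem).resolve_left (h.ne_zero hβ)).ne'
  · have hneg := eq_zero_or_map_pos_of_mem_hull hpos hmem
    simpa using (hneg.resolve_left (neg_ne_zero.2 (h.ne_zero hβ))).ne'

lemma inner_apply_ne_zero {β : V} (hβ : β ∈ Φ) {w : V ≃ₗᵢ[ℝ] V} (hw : w ∈ W) :
    ⟪β, w a⟫_ℝ ≠ 0 := by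
  have hne := h.inner_ne_zero (h.stable _ (inv_mem hw) β hβ)
  rwa [← w.inner_map_map, real_inner_comm, ← Function.comp_apply (f := w),
    ← LinearIsometryEquiv.coe_mul, mul_inv_cancel] at hne

lemma mem_hull_of_inner_pos {β : V} (hβ : β ∈ Φ) (hpos : 0 < ⟪a, β⟫_ℝ) :
    β ∈ PointedCone.hull ℝ Δ := by
  refine (h.isSimpleSystem.mem_hull_or_neg_mem_hull (fun _ => h.neg_mem) hβ).resolve_right
    fun hmem => ?_
  have hneg := map_nonneg_of_mem_hull (f := innerₗ V a) (fun α hα => (h.inner_pos α hα).le) hmem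
  rw [map_neg, innerₗ_apply_apply] at hneg
  linarith

lemma eq_zero_of_smul_mem_hull_sdiff {α : V} (hα : α ∈ Δ) {t : ℝ}
    (ht : t • α ∈ PointedCone.hull ℝ (Δ \ {α})) : t • α = 0 := by
  have htnonpos : t ≤ 0 := not_lt.1 fun hpos =>
    h.isSimpleSystem.notMem_hull_sdiff hα ((PointedCone.smul_mem_iff _ hpos).1 ht)
  refine (eq_zero_or_map_pos_of_mem_hull (f := innerₗ V a) (fun β hβ => h.inner_pos β hβ.1)
    ht).resolve_right (not_lt.2 ?_)
  simpa using mul_nonpos_of_nonpos_of_nonneg htnonpos (h.inner_pos α hα).le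

/-- Modulo the line `ℝ α`, the roots `β` and `s_α β` agree; if `s_α β` were negative, this would
write a multiple of `α` as a nonnegative combination of the other simple roots. -/
lemma inner_rootRefl_pos {α β : V} (hα : α ∈ Δ) (hβ : β ∈ Φ) (hpos : 0 < ⟪a, β⟫_ℝ)
    (hne : β ≠ α) : 0 < ⟪a, rootRefl α β⟫_ℝ := by
  have hreflΦ := h.stable _ (h.rootRefl_mem (h.subset hα)) β hβ
  refine (h.inner_ne_zero hreflΦ).lt_or_gt.resolve_left fun hneg => ?_
  obtain ⟨c, -, z, hz, hβz⟩ := (mem_hull_iff_exists_smul_add hα).1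
    (h.mem_hull_of_inner_pos hβ hpos)
  obtain ⟨d, -, z', hz', hβz'⟩ := (mem_hull_iff_exists_smul_add hα).1
    (h.mem_hull_of_inner_pos (h.neg_mem hreflΦ) (by rwa [inner_neg_right, neg_pos]))
  have hsum : z + z' = (2 * (⟪α, β⟫_ℝ / ‖α‖ ^ 2) - c - d) • α := by
    rw [rootRefl_apply, neg_sub, sub_eq_iff_eq_add] at hβz'
    rw [sub_smul, sub_smul, hβz']
    nth_rw 1 [hβz]
    abel
  have hsum0 : z + z' = 0 := by
    rw [hsum]
    exact h.eq_zero_of_smul_mem_hull_sdiff hα (hsum ▸ add_mem hz hz')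
  have hz0 : z = 0 := eq_zero_of_add_eq_zero_of_mem_hull (f := innerₗ V a)
    (fun γ hγ => h.inner_pos γ hγ.1) hz hz' hsum0
  rw [hz0, add_zero] at hβz
  obtain rfl | rfl : β = α ∨ β = -α := hβz ▸ h.eq_or_eq_neg (h.subset hα) (hβz ▸ hβ)
  · exact hne rfl
  · rw [inner_neg_right] at hpos
    linarith [h.inner_pos α hα]

lemma inner_nonpos {α β : V} (hα : α ∈ Δ) (hβ : β ∈ Δ) (hne : α ≠ β) : ⟪α, β⟫_ℝ ≤ 0 := by
  by_contra! hpos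
  set c := 2 * (⟪α, β⟫_ℝ / ‖α‖ ^ 2)
  have hα0 := h.ne_zero (h.subset hα)
  have hc : 0 < c := by positivity
  have hrefl := h.inner_rootRefl_pos hα (h.subset hβ) (h.inner_pos β hβ) hne.symm
  obtain ⟨t, -, z, hz, hzeq⟩ := (mem_hull_iff_exists_smul_add hβ).1
    (h.mem_hull_of_inner_pos (h.stable _ (h.rootRefl_mem (h.subset hα)) β (h.subset hβ)) hrefl)
  have hsum : c • α + z = (1 - t) • β := by
    rw [rootRefl_apply, sub_eq_iff_eq_add] at hzeq
    rw [sub_smul, one_smul, eq_sub_iff_add_eq]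
    nth_rw 2 [hzeq]
    abel
  have hcα : c • α ∈ PointedCone.hull ℝ (Δ \ {β}) :=
    PointedCone.smul_mem _ hc.le (PointedCone.subset_hull ⟨hα, hne⟩)
  have hsum0 : c • α + z = 0 :=
    hsum ▸ h.eq_zero_of_smul_mem_hull_sdiff hβ (hsum ▸ add_mem hcα hz)
  have hcα0 := eq_zero_of_add_eq_zero_of_mem_hull (f := innerₗ V a)
    (fun γ hγ => h.inner_pos γ hγ.1) hcα hz hsum0
  exact (smul_ne_zero hc.ne' hα0) hcα0

lemma linearIndepOn : LinearIndepOn ℝ id Δ :=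
  LinearMap.BilinForm.linearIndependent_of_pairwise_le_zero (innerₗ V)
    (fun _ hx => real_inner_self_pos.2 hx) (innerₗ V a) _ (fun α => h.inner_pos α α.2)
    fun α β hne => h.inner_nonpos α.2 β.2 (Subtype.coe_injective.ne hne)

lemma rootRefl_injOn : Set.InjOn rootRefl Δ := by
  intro α hα β hβ heq
  by_contra hne
  have hpos := h.inner_rootRefl_pos hα (h.subset hβ) (h.inner_pos β hβ) (Ne.symm hne)
  rw [heq, rootRefl_self, inner_neg_right] at hpos
  linarith [h.inner_pos β hβ]

lemma exists_inner_pos {β : V} (hβ : β ∈ Φ) (hpos : 0 < ⟪a, β⟫_ℝ) : ∃ α ∈ Δ, 0 < ⟪α, β⟫_ℝ := by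
  by_contra! hnonpos
  have hle := map_nonneg_of_mem_hull (f := -innerₗ V β)
    (fun α hα => by simpa [real_inner_comm] using hnonpos α hα) (h.mem_hull_of_inner_pos hβ hpos)
  exact h.ne_zero hβ (real_inner_self_nonpos.1 (by simpa using hle))

/-- As long as a positive root is not simple, some simple reflection keeps it positive and lowers
its inner product with `a`. -/
lemma exists_mem_reflGroup_apply_mem {β : V} (hβ : β ∈ Φ) (hpos : 0 < ⟪a, β⟫_ℝ) :
    ∃ w ∈ reflGroup Δ, w β ∈ Δ := by
  have hfin : {γ ∈ Φ | 0 < ⟪a, γ⟫_ℝ ∧ ∃ w ∈ reflGroup Δ, w β = γ}.Finite :=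
    h.finite.subset fun _ hγ => hγ.1
  obtain ⟨_, ⟨hγ, hγpos, w, hw, rfl⟩, hmin⟩ :=
    Set.exists_min_image _ (fun γ => ⟪a, γ⟫_ℝ) hfin ⟨β, hβ, hpos, 1, one_mem _, rfl⟩
  refine ⟨w, hw, by_contra fun hγΔ => ?_⟩
  obtain ⟨α, hα, hαpos⟩ := h.exists_inner_pos hγ hγpos
  have hreflpos := h.inner_rootRefl_pos hα hγ hγpos (ne_of_mem_of_not_mem hα hγΔ).symm
  have hle := hmin _ ⟨h.stable _ (h.rootRefl_mem (h.subset hα)) _ hγ, hreflpos,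
    rootRefl α * w, mul_mem (rootRefl_mem_reflGroup hα) hw, rfl⟩
  exact hle.not_gt ((map_rootRefl_lt_iff (f := innerSL ℝ a) hαpos).2 (h.inner_pos α hα))

lemma eq_reflGroup : W = reflGroup Δ := by
  have hpos : ∀ β ∈ Φ, 0 < ⟪a, β⟫_ℝ → rootRefl β ∈ reflGroup Δ := by
    intro β hβ hβpos
    obtain ⟨w, hw, hwβ⟩ := h.exists_mem_reflGroup_apply_mem hβ hβpos
    have hconj := mul_mem (mul_mem (inv_mem hw) (rootRefl_mem_reflGroup hwβ)) hw
    rwa [← conj_rootRefl, mul_assoc, inv_mul_cancel_right, inv_mul_cancel_left] at hconj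
  rw [h.generates]
  refine le_antisymm ((Subgroup.closure_le _).2 ?_) (reflGroup_mono h.subset)
  rintro _ ⟨β, hβ, rfl⟩
  rcases (h.inner_ne_zero hβ).lt_or_gt with hneg | hβpos
  · exact rootRefl_neg β ▸ hpos (-β) (h.neg_mem hβ) (by simpa using hneg)
  · exact hpos β hβ hβpos

lemma reflGroup_le {D : Set V} (hD : D ⊆ Δ) : reflGroup D ≤ W :=
  h.eq_reflGroup ▸ reflGroup_mono hD

lemma strong_exchange {β : V} (hβ : β ∈ Φ) (hpos : 0 < ⟪a, β⟫_ℝ) (l : List Δ)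
    (hneg : ⟪β, wordProd l a⟫_ℝ < 0) :
    ∃ l' : List Δ, l'.length + 1 = l.length ∧ wordProd l' = rootRefl β * wordProd l := by
  induction l generalizing β with
  | nil => exact absurd hneg (real_inner_comm β a ▸ hpos).not_gt
  | cons γ t ih =>
    rw [wordProd_cons] at hneg ⊢
    by_cases hβγ : β = γ
    · exact ⟨t, rfl, by rw [hβγ, ← mul_assoc, rootRefl_mul_self, one_mul]⟩
    have hγ := h.stable _ (h.rootRefl_mem (h.subset γ.2)) β hβ
    obtain ⟨l', hlen, hprod⟩ := ih hγ (h.inner_rootRefl_pos γ.2 hβ hpos hβγ)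
      (by rwa [inner_rootRefl_left])
    refine ⟨γ :: l', by simp [hlen], ?_⟩
    rw [wordProd_cons, hprod, ← conj_rootRefl, rootRefl_inv]
    simp only [← mul_assoc, rootRefl_mul_self, one_mul]

/-- The exchange condition shortens every nonempty word for such a `w`. -/
lemma eq_one_of_forall_inner_nonneg {w : V ≃ₗᵢ[ℝ] V} (hw : w ∈ W)
    (hdom : ∀ α ∈ Δ, 0 ≤ ⟪α, w a⟫_ℝ) : w = 1 := by
  obtain ⟨l, rfl⟩ := exists_wordProd_eq (h.eq_reflGroup ▸ hw)
  induction hn : l.length using Nat.strong_induction_on generalizing l with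
  | _ n ih =>
    cases l with
    | nil => rfl
    | cons γ t =>
      have hle : ⟪(γ : V), wordProd t a⟫_ℝ ≤ 0 := by
        have hγ := hdom γ γ.2
        rwa [wordProd_cons, LinearIsometryEquiv.coe_mul, Function.comp_apply,
          ← inner_rootRefl_left, rootRefl_self, inner_neg_left, neg_nonneg] at hγ
      have ht : wordProd t ∈ W := h.eq_reflGroup ▸ wordProd_mem_reflGroup t
      have hlt := hle.lt_of_ne (h.inner_apply_ne_zero (h.subset γ.2) ht)
      obtain ⟨l', hlen, hprod⟩ := h.strong_exchange (h.subset γ.2)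
        (h.inner_pos γ γ.2) t hlt
      rw [← wordProd_cons] at hprod
      rw [← hprod] at hw hdom ⊢
      refine ih l'.length ?_ l' hw hdom rfl
      rw [← hn, List.length_cons]
      lia

lemma eq_one_of_apply_eq {w : V ≃ₗᵢ[ℝ] V} (hw : w ∈ W) (hwa : w a = a) : w = 1 :=
  h.eq_one_of_forall_inner_nonneg hw fun α hα => by
    rw [hwa, real_inner_comm]
    exact (h.inner_pos α hα).le

lemma isGeneric : IsGeneric W a := by
  rintro s hs ⟨α, hα, rfl⟩ hfix
  exact rootRefl_ne_one hα (h.eq_one_of_apply_eq hs hfix)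

/-- In the coset of `w` modulo the stabilizer of `f`, the element `g` whose `g a` is highest in the
direction of `a` sends `a` into the closed chamber. -/
lemma mem_reflGroup_of_forall_map_apply_le {f : StrongDual ℝ V} (hf : ∀ α ∈ Δ, 0 ≤ f α)
    {w : V ≃ₗᵢ[ℝ] V} (hw : w ∈ W) (hmax : ∀ g ∈ W, f (g a) ≤ f (w a)) :
    w ∈ reflGroup {α ∈ Δ | f α = 0} := by
  set D := {α ∈ Δ | f α = 0}
  have hDW : reflGroup D ≤ W := h.reflGroup_le (Set.sep_subset _ _)
  have := h.finite_group
  have : Finite (reflGroup D) := Finite.of_injective _ (Subgroup.inclusion_injective hDW)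
  obtain ⟨⟨v, hv⟩, hvmax⟩ :=
    Finite.exists_max fun v : reflGroup D => innerSL ℝ a ((v : V ≃ₗᵢ[ℝ] V) (w a))
  have hvw : v * w = 1 := by
    refine h.eq_one_of_forall_inner_nonneg (mul_mem (hDW hv) hw) fun α hα => ?_
    by_contra! hneg
    rcases (hf α hα).eq_or_lt with hfα | hfα
    · have hle := hvmax ⟨rootRefl α * v, mul_mem (rootRefl_mem_reflGroup ⟨hα, hfα.symm⟩) hv⟩
      exact hle.not_gt ((lt_map_rootRefl_iff hneg).2 (h.inner_pos α hα))
    · have hle := hmax (rootRefl α * (v * w))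
        (mul_mem (h.rootRefl_mem (h.subset hα)) (mul_mem (hDW hv) hw))
      rw [← map_apply_of_mem_reflGroup (fun β hβ => hβ.2) hv (w a)] at hle
      exact hle.not_gt ((lt_map_rootRefl_iff hneg).2 hfα)
  exact inv_eq_of_mul_eq_one_right hvw ▸ inv_mem hv

lemma exists_strongDual_vanishing {D : Set V} (hD : D ⊆ Δ) :
    ∃ f : StrongDual ℝ V, (∀ α ∈ Δ, 0 ≤ f α) ∧ {α ∈ Δ | f α = 0} = D := by
  classical
  have : Finite Δ := h.finite.subset h.subset
  obtain ⟨f, hf⟩ := exists_strongDual_apply_eq h.linearIndepOn (Dᶜ.indicator 1 ∘ Subtype.val)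
  have hfα : ∀ α ∈ Δ, f α = Dᶜ.indicator 1 α := fun α hα => hf ⟨α, hα⟩
  refine ⟨f, fun α hα => ?_, Set.ext fun α => ⟨fun ⟨hα, h0⟩ => ?_, fun hα => ⟨hD hα, ?_⟩⟩⟩
  · exact hfα α hα ▸ Set.indicator_nonneg (fun _ _ => zero_le_one) α
  · by_contra hαD
    simp [hfα α hα, hαD] at h0
  · simp [hfα α (hD hα), hα]

end IsBasedRootSystem

end RootSystems

section OrbitHulls

/-- The convex hull of the points `g a` with `g ∈ C`. For a subgroup `C` this is `Perm a C`, for a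
coset `C = w W_I` it is the face `w(F_I)`. -/
def orbitHull (a : V) (C : Set (V ≃ₗᵢ[ℝ] V)) : Set V := convexHull ℝ ((fun g => g a) '' C)

variable {a : V} {G W : Subgroup (V ≃ₗᵢ[ℝ] V)}

lemma apply_mem_orbitHull {C : Set (V ≃ₗᵢ[ℝ] V)} {g : V ≃ₗᵢ[ℝ] V} (hg : g ∈ C) :
    g a ∈ orbitHull a C :=
  subset_convexHull ℝ _ ⟨g, hg, rfl⟩

lemma orbitHull_mono {C C' : Set (V ≃ₗᵢ[ℝ] V)} (h : C ⊆ C') : orbitHull a C ⊆ orbitHull a C' :=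
  convexHull_mono (Set.image_mono h)

lemma image_orbitHull (w : V ≃ₗᵢ[ℝ] V) (C : Set (V ≃ₗᵢ[ℝ] V)) :
    w '' orbitHull a C = orbitHull a (w • C) := by
  refine (w.toLinearEquiv.toLinearMap.image_convexHull _).trans (congrArg (convexHull ℝ) ?_)
  simp only [← Set.image_smul, Set.image_image]
  rfl

lemma toExposed_orbitHull (f : StrongDual ℝ V) (C : Set (V ≃ₗᵢ[ℝ] V)) :
    f.toExposed (orbitHull a C) = orbitHull a {g ∈ C | ∀ k ∈ C, f (k a) ≤ f (g a)} := by
  refine (toExposed_convexHull f _).trans (congrArg (convexHull ℝ) ?_)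
  ext x
  constructor
  · rintro ⟨⟨g, hg, rfl⟩, hmax⟩
    exact ⟨g, ⟨hg, Set.forall_mem_image.1 hmax⟩, rfl⟩
  · rintro ⟨g, ⟨hg, hmax⟩, rfl⟩
    exact ⟨⟨g, hg, rfl⟩, Set.forall_mem_image.2 hmax⟩

lemma perm_eq_orbitHull : Perm a G = orbitHull a G := by
  simp only [Perm, orbitHull, Set.image, SetLike.mem_coe, eq_comm]

lemma apply_mem_perm {g : V ≃ₗᵢ[ℝ] V} (hg : g ∈ G) : g a ∈ Perm a G :=
  subset_convexHull ℝ _ ⟨g, hg, rfl⟩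

lemma image_perm (w : V ≃ₗᵢ[ℝ] V) :
    w '' Perm a G = orbitHull a (w • (G : Set (V ≃ₗᵢ[ℝ] V))) := by
  rw [perm_eq_orbitHull, image_orbitHull]

lemma image_perm_of_mem {w : V ≃ₗᵢ[ℝ] V} (hw : w ∈ G) : w '' Perm a G = Perm a G := by
  rw [image_perm, smul_coe_set hw, perm_eq_orbitHull]

lemma image_perm_eq_perm_map_conj (w : V ≃ₗᵢ[ℝ] V) :
    w '' Perm a G = Perm (w a) (G.map (MulAut.conj w).toMonoidHom) := by
  refine (w.toLinearEquiv.toLinearMap.image_convexHull _).trans (congrArg (convexHull ℝ) ?_)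
  have hconj : ∀ g : V ≃ₗᵢ[ℝ] V, (w * g * w⁻¹) (w a) = w (g a) := fun g =>
    congrArg (fun x => w (g x)) (w.symm_apply_apply a)
  ext x
  constructor
  · rintro ⟨_, ⟨g, hg, rfl⟩, rfl⟩
    exact ⟨w * g * w⁻¹, ⟨g, hg, rfl⟩, (hconj g).symm⟩
  · rintro ⟨_, ⟨g, hg, rfl⟩, rfl⟩
    exact ⟨g a, ⟨g, hg, rfl⟩, (hconj g).symm⟩

lemma direction_affineSpan_perm_reflGroup {D : Set V} (ha : ∀ α ∈ D, ⟪a, α⟫_ℝ ≠ 0) :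
    (affineSpan ℝ (Perm a (reflGroup D))).direction = Submodule.span ℝ D := by
  have horbit : ∀ g ∈ reflGroup D, g a ∈ {x | ∃ g ∈ reflGroup D, x = g a} :=
    fun g hg => ⟨g, hg, rfl⟩
  have ha_mem : a ∈ _ := horbit 1 (one_mem _)
  rw [Perm, affineSpan_convexHull, direction_affineSpan]
  refine le_antisymm ?_ (Submodule.span_le.2 fun α hα => ?_)
  · rw [vectorSpan_eq_span_vsub_set_right ℝ ha_mem, Submodule.span_le]
    rintro _ ⟨_, ⟨g, hg, rfl⟩, rfl⟩
    exact apply_sub_mem_span hg a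
  · have hmem := vsub_mem_vectorSpan ℝ ha_mem (horbit _ (rootRefl_mem_reflGroup hα))
    rw [vsub_eq_sub, rootRefl_apply, sub_sub_cancel] at hmem
    have hc : 2 * (⟪α, a⟫_ℝ / ‖α‖ ^ 2) ≠ 0 := by
      have hinner := ha α hα
      have hα0 : α ≠ 0 := by
        rintro rfl
        simp at hinner
      rw [real_inner_comm] at hinner
      positivity
    exact (Submodule.smul_mem_iff _ hc).1 hmem

lemma HasDim.image {F : Set V} {k : ℕ} (hF : HasDim F k) (w : V ≃ₗᵢ[ℝ] V) :
    HasDim (w '' F) k := by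
  refine ⟨hF.1.image w, ?_⟩
  have hdir : vectorSpan ℝ (w '' F) = (vectorSpan ℝ F).map w.toLinearEquiv.toLinearMap :=
    (AffineMap.map_vectorSpan w.toLinearEquiv.toLinearMap.toAffineMap).symm
  rw [direction_affineSpan, hdir, LinearEquiv.finrank_map_eq, ← direction_affineSpan, hF.2]

end OrbitHulls

section Conjugation

variable {G H : Subgroup (V ≃ₗᵢ[ℝ] V)} {a : V}

lemma IsRefl.conj {s : V ≃ₗᵢ[ℝ] V} (hs : IsRefl s) (w : V ≃ₗᵢ[ℝ] V) : IsRefl (w * s * w⁻¹) := by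
  obtain ⟨α, hα, rfl⟩ := hs
  exact ⟨w α, by simpa using hα, conj_rootRefl w α⟩

lemma IsFiniteReflectionGroup.map_conj (hG : IsFiniteReflectionGroup G) (w : V ≃ₗᵢ[ℝ] V) :
    IsFiniteReflectionGroup (G.map (MulAut.conj w).toMonoidHom) := by
  obtain ⟨hfin, R, hR, rfl⟩ := hG
  refine ⟨((Set.toFinite _).image _).to_subtype, _, ?_, MonoidHom.map_closure _ _⟩
  rintro _ ⟨s, hs, rfl⟩
  exact (hR s hs).conj w

lemma IsGeneric.mono (ha : IsGeneric H a) (hGH : G ≤ H) : IsGeneric G a :=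
  fun s hs => ha s (hGH hs)

lemma IsGeneric.map_conj (ha : IsGeneric G a) (w : V ≃ₗᵢ[ℝ] V) :
    IsGeneric (G.map (MulAut.conj w).toMonoidHom) (w a) := by
  rintro _ ⟨g, hg, rfl⟩ hs hfix
  have hrefl : IsRefl g := by simpa [mul_assoc] using hs.conj w⁻¹
  have hconj : (w * g * w⁻¹) (w a) = w (g a) :=
    congrArg (fun x => w (g x)) (w.symm_apply_apply a)
  exact ha g hg hrefl (w.injective (hconj.symm.trans hfix))

end Conjugation

section Faces

variable {W : Subgroup (V ≃ₗᵢ[ℝ] V)} {Φ Δ : Set V}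

namespace IsBasedRootSystem

variable {a : V} (h : IsBasedRootSystem W Φ Δ a) {D E : Set V}
include h

lemma toExposed_perm {f : StrongDual ℝ V} (hf : ∀ α ∈ Δ, 0 ≤ f α) :
    f.toExposed (Perm a W) = Perm a (reflGroup {α ∈ Δ | f α = 0}) := by
  have := h.finite_group
  obtain ⟨⟨m, hm⟩, hmax⟩ := Finite.exists_max fun w : W => f ((w : V ≃ₗᵢ[ℝ] V) a)
  have hfix : ∀ w ∈ reflGroup {α ∈ Δ | f α = 0}, f (w a) = f a := fun w hw =>
    map_apply_of_mem_reflGroup (fun α hα => hα.2) hw a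
  have hle : ∀ w ∈ W, f (w a) ≤ f a := fun w hw =>
    hfix m (h.mem_reflGroup_of_forall_map_apply_le hf hm fun g hg => hmax ⟨g, hg⟩) ▸ hmax ⟨w, hw⟩
  rw [perm_eq_orbitHull, perm_eq_orbitHull, toExposed_orbitHull]
  congr 1
  ext w
  constructor
  · rintro ⟨hw, hwmax⟩
    exact h.mem_reflGroup_of_forall_map_apply_le hf hw hwmax
  · intro hw
    exact ⟨h.reflGroup_le (Set.sep_subset _ _) hw, fun g hg => (hle g hg).trans_eq (hfix w hw).symm⟩

lemma isExposed_image_perm (hD : D ⊆ Δ) {w : V ≃ₗᵢ[ℝ] V} (hw : w ∈ W) :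
    IsExposed ℝ (Perm a W) (w '' Perm a (reflGroup D)) := by
  obtain ⟨f, hf, rfl⟩ := h.exists_strongDual_vanishing hD
  have hface := isExposed_image (ContinuousLinearMap.toExposed.isExposed (l := f) (A := Perm a W))
    w.toContinuousLinearEquiv
  rw [h.toExposed_perm hf] at hface
  exact (image_perm_of_mem (a := a) hw) ▸ hface

lemma exists_eq_image_perm {F : Set V} (hF : IsExposed ℝ (Perm a W) F) (hne : F.Nonempty) :
    ∃ w ∈ W, ∃ D ⊆ Δ, F = w '' Perm a (reflGroup D) := by
  obtain ⟨f, rfl⟩ := hF hne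
  have := h.finite_group
  obtain ⟨u, hu, hdom⟩ := exists_forall_map_apply_nonneg W
    (fun α hα => h.rootRefl_mem (h.subset hα)) h.inner_pos f
  refine ⟨u, hu, {α ∈ Δ | f (u α) = 0}, Set.sep_subset _ _, ?_⟩
  calc f.toExposed (Perm a W) = f.toExposed (u '' Perm a W) := by rw [image_perm_of_mem hu]
    _ = u '' (f.comp (u : V →L[ℝ] V)).toExposed (Perm a W) :=
      (image_toExposed_comp f (u : V →L[ℝ] V) _).symm
    _ = u '' Perm a (reflGroup {α ∈ Δ | f (u α) = 0}) :=
      congrArg (u '' ·) (h.toExposed_perm (f := f.comp (u : V →L[ℝ] V)) hdom)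

lemma apply_mem_orbitHull_iff (hD : D ⊆ Δ) {u g : V ≃ₗᵢ[ℝ] V} (hu : u ∈ W) (hg : g ∈ W) :
    u a ∈ orbitHull a (g • (reflGroup D : Set (V ≃ₗᵢ[ℝ] V))) ↔
      u ∈ g • (reflGroup D : Set (V ≃ₗᵢ[ℝ] V)) := by
  refine ⟨fun hmem => ?_, apply_mem_orbitHull⟩
  obtain ⟨f, hf, hfD⟩ := h.exists_strongDual_vanishing hD
  rw [← image_perm, ← hfD, ← h.toExposed_perm hf] at hmem
  obtain ⟨x, ⟨-, hmax⟩, hx⟩ := hmem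
  obtain rfl : x = (g⁻¹ * u) a := (g.symm_apply_eq.2 hx.symm).symm
  rw [Set.mem_smul_set_iff_inv_smul_mem, smul_eq_mul, SetLike.mem_coe, ← hfD]
  refine h.mem_reflGroup_of_forall_map_apply_le hf (mul_mem (inv_mem hg) hu) fun k hk => ?_
  exact hmax _ (apply_mem_perm hk)

lemma image_perm_subset_iff (hD : D ⊆ Δ) (hE : E ⊆ Δ) {w g : V ≃ₗᵢ[ℝ] V} (hw : w ∈ W)
    (hg : g ∈ W) :
    w '' Perm a (reflGroup D) ⊆ g '' Perm a (reflGroup E) ↔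
      w • (reflGroup D : Set (V ≃ₗᵢ[ℝ] V)) ⊆ g • (reflGroup E : Set (V ≃ₗᵢ[ℝ] V)) := by
  rw [image_perm, image_perm]
  refine ⟨fun hsub u hu => ?_, orbitHull_mono⟩
  have huW : u ∈ W := by
    obtain ⟨k, hk, rfl⟩ := hu
    exact mul_mem hw (h.reflGroup_le hD hk)
  exact (h.apply_mem_orbitHull_iff hE huW hg).1 (hsub (apply_mem_orbitHull hu))

lemma image_perm_eq_iff (hD : D ⊆ Δ) (hE : E ⊆ Δ) {w g : V ≃ₗᵢ[ℝ] V} (hw : w ∈ W) (hg : g ∈ W) :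
    w '' Perm a (reflGroup D) = g '' Perm a (reflGroup E) ↔
      w • (reflGroup D : Set (V ≃ₗᵢ[ℝ] V)) = g • (reflGroup E : Set (V ≃ₗᵢ[ℝ] V)) := by
  rw [Set.Subset.antisymm_iff, Set.Subset.antisymm_iff, h.image_perm_subset_iff hD hE hw hg,
    h.image_perm_subset_iff hE hD hg hw]

lemma hasDim_image_perm (hD : D ⊆ Δ) (w : V ≃ₗᵢ[ℝ] V) :
    HasDim (w '' Perm a (reflGroup D)) (rootRefl '' D).ncard := by
  refine HasDim.image ⟨⟨a, apply_mem_perm (one_mem _)⟩, ?_⟩ w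
  have := ((h.finite.subset h.subset).subset hD).fintype
  rw [direction_affineSpan_perm_reflGroup fun α hα => (h.inner_pos α (hD hα)).ne',
    finrank_span_set_eq_card (h.linearIndepOn.mono hD), (h.rootRefl_injOn.mono hD).ncard_image,
    Set.ncard_eq_toFinset_card']

lemma isFiniteReflectionGroup_reflGroup (hD : D ⊆ Δ) : IsFiniteReflectionGroup (reflGroup D) := by
  have := h.finite_group
  refine ⟨Finite.of_injective _ (Subgroup.inclusion_injective (h.reflGroup_le hD)), _, ?_, rfl⟩
  rintro _ ⟨α, hα, rfl⟩
  exact ⟨α, h.ne_zero (h.subset (hD hα)), rfl⟩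

end IsBasedRootSystem

end Faces

section FaceLattice

lemma exists_orderIso_withBot {α β : Type*} [PartialOrder α] [PartialOrder β] [OrderBot β]
    (f : α ↪o β) (hf : Set.range f = {⊥}ᶜ) : ∃ e : β ≃o WithBot α, ∀ x, e (f x) = x := by
  classical
  let g : α ≃o {b : β // b ≠ ⊥} := f.orderIso.trans (OrderIso.setCongr _ _ hf)
  refine ⟨WithBot.subtypeOrderIso.symm.trans g.symm.withBotCongr, fun x => ?_⟩
  have hx : f x ≠ ⊥ := hf.subset ⟨x, rfl⟩
  rw [OrderIso.trans_apply, WithBot.subtypeOrderIso_symm_apply hx]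
  exact congrArg WithBot.some (g.symm_apply_apply x)

instance (P : Set V) : OrderBot (FaceLattice P) := Subtype.orderBot isExposed_empty

lemma ne_bot_iff_nonempty {P : Set V} {F : FaceLattice P} : F ≠ ⊥ ↔ (F : Set V).Nonempty := by
  rw [Set.nonempty_iff_ne_empty]
  exact Subtype.coe_injective.ne_iff.symm

variable {W : Subgroup (V ≃ₗᵢ[ℝ] V)} {Φ Δ : Set V} {a : V}

lemma exists_eq_smul_reflGroup (C : ParabolicCosets W (simpleReflections Δ)) :
    ∃ w ∈ W, ∃ D ⊆ Δ, (C : Set (V ≃ₗᵢ[ℝ] V)) = w • (reflGroup D : Set (V ≃ₗᵢ[ℝ] V)) := by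
  obtain ⟨_, w, hw, I, hI, rfl⟩ := C
  obtain ⟨D, hD, rfl⟩ := Set.subset_image_iff.1 hI
  exact ⟨w, hw, D, hD, rfl⟩

namespace IsBasedRootSystem

variable (h : IsBasedRootSystem W Φ Δ a)
include h

lemma isExposed_orbitHull (C : ParabolicCosets W (simpleReflections Δ)) :
    IsExposed ℝ (Perm a W) (orbitHull a C) := by
  obtain ⟨w, hw, D, hD, hC⟩ := exists_eq_smul_reflGroup C
  rw [hC, ← image_perm]
  exact h.isExposed_image_perm hD hw

lemma orbitHull_subset_iff (C C' : ParabolicCosets W (simpleReflections Δ)) :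
    orbitHull a C ⊆ orbitHull a C' ↔ C ≤ C' := by
  obtain ⟨w, hw, D, hD, hC⟩ := exists_eq_smul_reflGroup C
  obtain ⟨g, hg, E, hE, hC'⟩ := exists_eq_smul_reflGroup C'
  rw [← Subtype.coe_le_coe, hC, hC', ← image_perm, ← image_perm]
  exact h.image_perm_subset_iff hD hE hw hg

/-- The order embedding `w W_I ↦ w(F_I)` of the parabolic cosets into the face lattice; only the
empty face is missing from its range. -/
def faceEmbedding : ParabolicCosets W (simpleReflections Δ) ↪o FaceLattice (Perm a W) :=
  OrderEmbedding.ofMapLEIff (fun C => ⟨orbitHull a C, h.isExposed_orbitHull C⟩)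
    h.orbitHull_subset_iff

lemma range_faceEmbedding : Set.range h.faceEmbedding = {⊥}ᶜ := by
  ext F
  rw [Set.mem_compl_singleton_iff, ne_bot_iff_nonempty]
  constructor
  · rintro ⟨C, rfl⟩
    obtain ⟨w, -, D, -, hC⟩ := exists_eq_smul_reflGroup C
    exact ⟨w a, apply_mem_orbitHull (hC ▸ ⟨1, one_mem _, mul_one w⟩)⟩
  · intro hne
    obtain ⟨w, hw, D, hD, hF⟩ := h.exists_eq_image_perm F.2 hne
    exact ⟨⟨_, w, hw, _, Set.image_mono hD, rfl⟩, Subtype.ext (hF.trans (image_perm w)).symm⟩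

lemma exists_orderIso_faceLattice :
    ∃ e : FaceLattice (Perm a W) ≃o WithBot (ParabolicCosets W (simpleReflections Δ)),
      ∀ (C : ParabolicCosets W (simpleReflections Δ)) (F : FaceLattice (Perm a W)),
        (F : Set V) = orbitHull a C → e F = C := by
  obtain ⟨e, he⟩ := exists_orderIso_withBot h.faceEmbedding h.range_faceEmbedding
  refine ⟨e, fun C F hF => ?_⟩
  rw [← he C]
  exact congrArg e (Subtype.ext hF)

end IsBasedRootSystem

end FaceLattice

end PermFaces

end

open PermFaces in
theorem mainTheorem3_general {V : Type*} [NormedAddCommGroup V] [InnerProductSpace ℝ V]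
    (W : Subgroup (V ≃ₗᵢ[ℝ] V)) (Φ : Set V) (hΦ : IsRootSystemFor W Φ) (a : V)
    (Δ : Set V) (hΔ : IsSimpleSystem Φ Δ) (haΔ : ∀ α ∈ Δ, 0 < inner ℝ a α) :
    (∀ (k : ℕ) (F : Set V), IsExposed ℝ (Perm a W) F → HasDim F k →
      ∃ w ∈ W, ∃ I ⊆ simpleReflections Δ, I.ncard = k ∧ F = w '' Perm a (Subgroup.closure I)) ∧
    (∀ w ∈ W, ∀ I ⊆ simpleReflections Δ,
      IsExposed ℝ (Perm a W) (w '' Perm a (Subgroup.closure I)) ∧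
      HasDim (w '' Perm a (Subgroup.closure I)) I.ncard ∧
      IsFiniteReflectionGroup ((Subgroup.closure I).map (MulAut.conj w).toMonoidHom) ∧
      IsGeneric ((Subgroup.closure I).map (MulAut.conj w).toMonoidHom) (w a) ∧
      w '' Perm a (Subgroup.closure I) =
        Perm (w a) ((Subgroup.closure I).map (MulAut.conj w).toMonoidHom)) ∧
    (∀ w ∈ W, ∀ g ∈ W, ∀ I ⊆ simpleReflections Δ,
      w '' Perm a (Subgroup.closure I) = g '' Perm a (Subgroup.closure I) ↔
        w • (Subgroup.closure I : Set (V ≃ₗᵢ[ℝ] V)) =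
          g • (Subgroup.closure I : Set (V ≃ₗᵢ[ℝ] V))) ∧
    (∀ w ∈ W, ∀ g ∈ W, ∀ I ⊆ simpleReflections Δ, ∀ J ⊆ simpleReflections Δ,
      w '' Perm a (Subgroup.closure I) ⊆ g '' Perm a (Subgroup.closure J) ↔
        w • (Subgroup.closure I : Set (V ≃ₗᵢ[ℝ] V)) ⊆
          g • (Subgroup.closure J : Set (V ≃ₗᵢ[ℝ] V))) ∧
    (∃ e : FaceLattice (Perm a W) ≃o WithBot (ParabolicCosets W (simpleReflections Δ)),
      ∀ (w : V ≃ₗᵢ[ℝ] V) (hw : w ∈ W) (I : Set (V ≃ₗᵢ[ℝ] V)) (hI : I ⊆ simpleReflections Δ)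
        (F : FaceLattice (Perm a W)), (F : Set V) = w '' Perm a (Subgroup.closure I) →
        e F = ((⟨w • (Subgroup.closure I : Set (V ≃ₗᵢ[ℝ] V)), w, hw, I, hI, rfl⟩ :
          ParabolicCosets W (simpleReflections Δ)) :
            WithBot (ParabolicCosets W (simpleReflections Δ)))) := by
  have h : IsBasedRootSystem W Φ Δ a := ⟨hΦ, hΔ, haΔ⟩
  simp only [simpleReflections, Set.forall_subset_image_iff]
  refine ⟨fun k F hF hdim => ?_, fun w hw D hD => ⟨h.isExposed_image_perm hD hw,
    h.hasDim_image_perm hD w, (h.isFiniteReflectionGroup_reflGroup hD).map_conj w,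
    (h.isGeneric.mono (h.reflGroup_le hD)).map_conj w, image_perm_eq_perm_map_conj w⟩,
    fun w hw g hg D hD => h.image_perm_eq_iff hD hD hw hg,
    fun w hw g hg D hD E hE => h.image_perm_subset_iff hD hE hw hg, ?_⟩
  · obtain ⟨w, hw, D, hD, rfl⟩ := h.exists_eq_image_perm hF hdim.1
    exact ⟨w, hw, _, Set.image_mono hD, (h.hasDim_image_perm hD w).2.symm.trans hdim.2, rfl⟩
  · obtain ⟨e, he⟩ := h.exists_orderIso_faceLattice
    exact ⟨e, fun w hw I hI F hF => he ⟨_, w, hw, I, hI, rfl⟩ F (hF.trans (image_perm w))⟩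

open PermFaces in
theorem mainTheorem3 {V : Type*} [NormedAddCommGroup V] [InnerProductSpace ℝ V]
    [FiniteDimensional ℝ V]
    (W : Subgroup (V ≃ₗᵢ[ℝ] V)) (hW : IsFiniteReflectionGroup W)
    (Φ : Set V) (hΦ : IsRootSystemFor W Φ)
    (a : V) (ha : IsGeneric W a)
    (Δ : Set V) (hΔ : IsSimpleSystem Φ Δ) (haΔ : ∀ α ∈ Δ, 0 < inner ℝ a α)
    (S : Set (V ≃ₗᵢ[ℝ] V)) (hS : S = simpleReflections Δ) :
    -- every `k`-dimensional face is `w(F_I)` with `|I| = k`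
    (∀ (k : ℕ) (F : Set V), IsExposed ℝ (Perm a W) F → HasDim F k →
      ∃ w ∈ W, ∃ I ⊆ S, I.ncard = k ∧ F = w '' Perm a (Subgroup.closure I)) ∧
    -- conversely, each `w(F_I)` is a face of dimension `|I|`, and it is the permutahedron of the
    -- finite reflection group `w W_I w⁻¹` at the generic point `w(a)`
    (∀ w ∈ W, ∀ I ⊆ S,
      IsExposed ℝ (Perm a W) (w '' Perm a (Subgroup.closure I)) ∧
      HasDim (w '' Perm a (Subgroup.closure I)) I.ncard ∧
      IsFiniteReflectionGroup ((Subgroup.closure I).map (MulAut.conj w).toMonoidHom) ∧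
      IsGeneric ((Subgroup.closure I).map (MulAut.conj w).toMonoidHom) (w a) ∧
      w '' Perm a (Subgroup.closure I) =
        Perm (w a) ((Subgroup.closure I).map (MulAut.conj w).toMonoidHom)) ∧
    -- equality of faces and of cosets
    (∀ w ∈ W, ∀ g ∈ W, ∀ I ⊆ S,
      w '' Perm a (Subgroup.closure I) = g '' Perm a (Subgroup.closure I) ↔
        w • (Subgroup.closure I : Set (V ≃ₗᵢ[ℝ] V)) =
          g • (Subgroup.closure I : Set (V ≃ₗᵢ[ℝ] V))) ∧
    -- inclusion of faces and of cosets
    (∀ w ∈ W, ∀ g ∈ W, ∀ I ⊆ S, ∀ J ⊆ S,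
      w '' Perm a (Subgroup.closure I) ⊆ g '' Perm a (Subgroup.closure J) ↔
        w • (Subgroup.closure I : Set (V ≃ₗᵢ[ℝ] V)) ⊆
          g • (Subgroup.closure J : Set (V ≃ₗᵢ[ℝ] V))) ∧
    -- the face lattice is the poset of cosets, with a least element added for the empty face
    (∃ e : FaceLattice (Perm a W) ≃o WithBot (ParabolicCosets W S),
      ∀ (w : V ≃ₗᵢ[ℝ] V) (hw : w ∈ W) (I : Set (V ≃ₗᵢ[ℝ] V)) (hI : I ⊆ S)
        (F : FaceLattice (Perm a W)), (F : Set V) = w '' Perm a (Subgroup.closure I) →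
        e F = ((⟨w • (Subgroup.closure I : Set (V ≃ₗᵢ[ℝ] V)), w, hw, I, hI, rfl⟩ :
          ParabolicCosets W S) : WithBot (ParabolicCosets W S))) := by
  subst hS
  exact mainTheorem3_general W Φ hΦ a Δ hΔ haΔ
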